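/- Let $K$ be a field, let $n>2$ be an integer, and let $G$ be a connected simple graph on the vertex set $[n]=\{1,\dots,n\}$. Let $S=K[X_1,\dots,X_n,Y_1,\dots,Y_n]$ be the polynomial ring in $2n$ variables, and for $i,j\in[n]$ put $$[i,j]:=\det\begin{pmatrix}X_i & X_j\\ Y_i & Y_j\end{pmatrix}=X_iY_j-Y_iX_j .$$ Let $I_G:=\left([i,j] \mid \{i,j\}\text{ is an edge of }G\right)\subset S$. A Hamilton path of $G$ is a path of $G$ (a walk with no repeated vertex) whose set of vertices is all of $[n]$. 1. If $G$ has a Hamilton path, then $\operatorname{ht} I_G=n-1$. 2. If $G$ is a tree (that is, $G$, which is connected, has no cycle) and $\operatorname{ht} I_G=n-1$, then $G$ has a Hamilton path. -/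

import Mathlib

open MvPolynomial

namespace BinomialEdge

/-- The `2`-minor `[i,j]` of the generic `2 × n` matrix over `K`. The polynomial ring has the
variables `X_i = X (0, i)` (first row) and `Y_i = X (1, i)` (second row). -/
noncomputable def minor (K : Type*) [Field K] {n : ℕ} (i j : Fin n) :
    MvPolynomial (Fin 2 × Fin n) K :=
  (!![X (0, i), X (0, j); X (1, i), X (1, j)] :
    Matrix (Fin 2) (Fin 2) (MvPolynomial (Fin 2 × Fin n) K)).det

theorem minor_eq (K : Type*) [Field K] {n : ℕ} (i j : Fin n) :
    minor K i j = X (0, i) * X (1, j) - X (1, i) * X (0, j) := by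
  rw [minor, Matrix.det_fin_two_of]
  ring

/-- The ideal `I_G` generated by the minors `[i,j]` with `{i,j}` an edge of `G`. Both orders of an
edge are allowed, which only adds the negatives of generators. -/
noncomputable def edgeIdeal (K : Type*) [Field K] {n : ℕ} (G : SimpleGraph (Fin n)) :
    Ideal (MvPolynomial (Fin 2 × Fin n) K) :=
  Ideal.span {f | ∃ i j : Fin n, G.Adj i j ∧ f = minor K i j}

/-- `G` has a Hamilton path: a path that visits every vertex. -/
def HasHamiltonPath {n : ℕ} (G : SimpleGraph (Fin n)) : Prop :=
  ∃ (a b : Fin n) (p : G.Walk a b), p.IsHamiltonian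

end BinomialEdge

/-! Relabel the columns along a Hamilton path, so that `I_G` contains the consecutive minors. Any
prime containing these has height at least the number of edges of the path: add one column at a time
and compare the prime with its contraction (`le_height_of_consecutive_minor_mem`). Conversely, some
minimal prime of the consecutive minors contains all minors, so Krull's height theorem gives `ht I_G
≤ n - 1` for every `G`. For a tree with a vertex of degree `d`, killing the column of that vertex
leaves `n - 1 - d` edges, so `ht I_G ≤ 2 + (n - 1 - d)`. Height `n - 1` thus forces `d ≤ 2`
everywhere, and the tree is a path. -/

namespace BinomialEdge

/-! ### Heights of primes under adjoining variables. -/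

section Extension

variable {R : Type*} [CommRing R]

theorem isPrime_map_C {σ : Type*} (p : Ideal R) [p.IsPrime] :
    (p.map (C : R →+* MvPolynomial σ R)).IsPrime := by
  rw [← Ideal.Quotient.isDomain_iff_prime]
  exact (MvPolynomial.quotientEquivQuotientMvPolynomial (σ := σ) p).symm.toMulEquiv.isDomain _

theorem comap_C_map_C {σ : Type*} (p : Ideal R) :
    (p.map (C : R →+* MvPolynomial σ R)).comap C = p := by
  refine le_antisymm (fun a ha => ?_) Ideal.le_comap_map
  simpa using mem_map_C_iff.1 (Ideal.mem_comap.1 ha) 0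

theorem X_notMem_map_C {σ : Type*} (p : Ideal R) [p.IsPrime] (i : σ) :
    (X i : MvPolynomial σ R) ∉ p.map (C : R →+* MvPolynomial σ R) := fun h =>
  (p.ne_top_iff_one.1 Ideal.IsPrime.ne_top') (by
    simpa using mem_map_C_iff.1 h (Finsupp.single i 1))

theorem height_le_height_map_C {σ : Type*} (p : Ideal R) [p.IsPrime] :
    p.height ≤ (p.map (C : R →+* MvPolynomial σ R)).height := by
  let f : PrimeSpectrum R → PrimeSpectrum (MvPolynomial σ R) :=
    fun q => ⟨q.asIdeal.map C, isPrime_map_C _⟩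
  have hf : StrictMono f := by
    refine Monotone.strictMono_of_injective (fun q r h => Ideal.map_mono h) fun q r h => ?_
    have h' : q.asIdeal.map (C : R →+* MvPolynomial σ R) = r.asIdeal.map C :=
      congrArg PrimeSpectrum.asIdeal h
    ext1
    rw [← comap_C_map_C (σ := σ) q.asIdeal, h', comap_C_map_C]
  have := Order.height_le_height_apply_of_strictMono f hf ⟨p, inferInstance⟩
  rwa [← PrimeSpectrum.height_eq_orderHeight, ← PrimeSpectrum.height_eq_orderHeight] at this

theorem height_comap_C_le {σ : Type*} (Q : Ideal (MvPolynomial σ R)) [Q.IsPrime] :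
    (Q.comap C).height ≤ Q.height :=
  (height_le_height_map_C (σ := σ) (Q.comap C)).trans (Ideal.height_mono Ideal.map_comap_le)

/-- The linear form has coefficients `a` and `-b`, so it lies outside the extension of the
contraction unless both `a` and `b` are in `Q`. -/
theorem height_comap_C_add_one_le (Q : Ideal (MvPolynomial (Fin 2) R)) [Q.IsPrime] {a b : R}
    (h : C a * X 1 - C b * X 0 ∈ Q) (hab : ¬ (C a ∈ Q ∧ C b ∈ Q)) :
    (Q.comap C).height + 1 ≤ Q.height := by
  have : ((Q.comap C).map (C : R →+* MvPolynomial (Fin 2) R)).IsPrime := isPrime_map_C _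
  have hlt : (Q.comap C).map C < Q := by
    refine lt_of_le_of_ne Ideal.map_comap_le fun e => hab ?_
    rw [← e] at h
    have h01 : Finsupp.single (0 : Fin 2) 1 ≠ Finsupp.single 1 1 := fun h => by
      simpa using DFunLike.congr_fun h 0
    have h1 := mem_map_C_iff.1 h (Finsupp.single 1 1)
    have h0 := mem_map_C_iff.1 h (Finsupp.single 0 1)
    simp only [coeff_sub, coeff_C_mul, coeff_X, if_neg h01, if_neg h01.symm, if_true] at h0 h1
    exact ⟨by simpa using h1, by simpa using h0⟩
  grw [height_le_height_map_C (σ := Fin 2) (Q.comap C)]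
  exact Ideal.height_add_one_le_of_lt_of_isPrime hlt

theorem height_comap_C_add_two_le (Q : Ideal (MvPolynomial (Fin 2) R)) [Q.IsPrime]
    (h0 : X 0 ∈ Q) (h1 : X 1 ∈ Q) :
    (Q.comap C).height + 2 ≤ Q.height := by
  set P := (Q.comap C).map (C : R →+* MvPolynomial (Fin 2) R) with hP
  have hPp : P.IsPrime := isPrime_map_C _
  have hPQ : P ≤ Q := Ideal.map_comap_le
  -- The preimage of `P` under `X 0 ↦ 0` is a prime strictly between `P` and `Q`; it lies in `Q`
  -- because `θ` is the identity modulo `Q`.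
  let θ : MvPolynomial (Fin 2) R →ₐ[R] MvPolynomial (Fin 2) R := aeval ![0, X 1]
  have hlt₁ : P < P.comap θ := by
    refine lt_of_le_of_ne ?_ fun e => X_notMem_map_C (Q.comap C) (0 : Fin 2) ?_
    · rw [hP, Ideal.map_le_iff_le_comap]
      intro a ha
      rw [Ideal.mem_comap, Ideal.mem_comap, algHom_C]
      exact Ideal.mem_map_of_mem _ ha
    · rw [← hP, e, Ideal.mem_comap]
      simp [θ]
  have hlt₂ : P.comap θ < Q := by
    refine lt_of_le_of_ne (fun f hf => ?_) fun e =>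
      X_notMem_map_C (Q.comap C) (1 : Fin 2) ?_
    · have hθ : (Ideal.Quotient.mkₐ R Q).comp θ = Ideal.Quotient.mkₐ R Q := by
        ext i
        fin_cases i
        · simpa [θ] using (Ideal.Quotient.eq_zero_iff_mem.2 h0).symm
        · simp [θ]
      have := DFunLike.congr_fun hθ f
      rw [← Ideal.Quotient.eq_zero_iff_mem]
      exact this.symm.trans (Ideal.Quotient.eq_zero_iff_mem.2 (hPQ hf))
    · rw [← e, Ideal.mem_comap] at h1
      simpa [θ] using h1
  have : (P.comap θ).IsPrime := Ideal.IsPrime.comap _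
  calc (Q.comap C).height + 2 ≤ P.height + 1 + 1 := by
        grw [height_le_height_map_C (σ := Fin 2) (Q.comap C)]
        rw [add_assoc, one_add_one_eq_two]
    _ ≤ (P.comap θ).height + 1 := by grw [Ideal.height_add_one_le_of_lt_of_isPrime hlt₁]
    _ ≤ Q.height := Ideal.height_add_one_le_of_lt_of_isPrime hlt₂

end Extension

/-! ### Lower bound by induction on the columns. -/

/-- Splitting off the last column of variables. -/
def lastColumnEquiv (n : ℕ) : Fin 2 × Fin (n + 1) ≃ Fin 2 ⊕ (Fin 2 × Fin n) where
  toFun x := Fin.lastCases (motive := fun _ => Fin 2 ⊕ (Fin 2 × Fin n)) (Sum.inl x.1)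
    (fun j => Sum.inr (x.1, j)) x.2
  invFun := Sum.elim (fun i => (i, Fin.last n)) fun x => (x.1, x.2.castSucc)
  left_inv := by
    rintro ⟨i, j⟩
    induction j using Fin.lastCases <;> simp
  right_inv := by
    rintro (i | ⟨i, j⟩) <;> simp

/-- The polynomial ring as a polynomial ring in the last column of variables over the polynomial
ring in the other columns. -/
noncomputable def lastColumnRingEquiv (K : Type*) [Field K] (n : ℕ) :
    MvPolynomial (Fin 2 × Fin (n + 1)) K ≃+*
      MvPolynomial (Fin 2) (MvPolynomial (Fin 2 × Fin n) K) :=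
  ((renameEquiv K (lastColumnEquiv n)).trans (sumAlgEquiv K (Fin 2) (Fin 2 × Fin n))).toRingEquiv

section

variable (K : Type*) [Field K]

theorem lastColumnRingEquiv_X_last (n : ℕ) (i : Fin 2) :
    lastColumnRingEquiv K n (X (i, Fin.last n)) = X i := by
  simp [lastColumnRingEquiv, lastColumnEquiv]

theorem lastColumnRingEquiv_X_castSucc (n : ℕ) (i : Fin 2) (j : Fin n) :
    lastColumnRingEquiv K n (X (i, j.castSucc)) = C (X (i, j)) := by
  simp [lastColumnRingEquiv, lastColumnEquiv]

/-- Height bounds for the primes that contain the consecutive minors. -/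
theorem le_height_of_consecutive_minor_mem (n : ℕ)
    (P : Ideal (MvPolynomial (Fin 2 × Fin (n + 1)) K)) [P.IsPrime]
    (hP : ∀ i : Fin n, minor K i.castSucc i.succ ∈ P) :
    (n : ℕ∞) ≤ P.height ∧ ((∀ i, X (i, Fin.last n) ∈ P) → (n + 1 : ℕ∞) ≤ P.height) := by
  induction n with
  | zero =>
    refine ⟨by simp, fun h => ?_⟩
    rw [Nat.cast_zero, zero_add, Order.one_le_iff_ne_zero, Ne, Ideal.height_eq_zero_iff_eq_bot]
    rintro rfl
    exact X_ne_zero _ ((Submodule.mem_bot _).1 (h 0))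
  | succ n ih =>
    let e := lastColumnRingEquiv K (n + 1)
    let Q := P.comap e.symm
    have hQP : Q.height = P.height := RingEquiv.height_comap e.symm P
    have hQp : Q.IsPrime := Ideal.IsPrime.comap _
    have hmem : ∀ f, e f ∈ Q ↔ f ∈ P := fun f => by simp [Q]
    have hp : ∀ i : Fin n, minor K i.castSucc i.succ ∈ Q.comap C := fun i => by
      have := (hmem _).2 (hP i.castSucc)
      rw [minor_eq] at this
      simp only [map_sub, map_mul, e, lastColumnRingEquiv_X_castSucc, Fin.succ_castSucc] at this
      simpa [minor_eq] using this
    obtain ⟨h1, h2⟩ := ih (Q.comap C) hp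
    have hlast : C (X (0, Fin.last n)) * X 1 - C (X (1, Fin.last n)) * X 0 ∈ Q := by
      have := (hmem _).2 (hP (Fin.last n))
      rw [minor_eq] at this
      simpa only [map_sub, map_mul, e, lastColumnRingEquiv_X_castSucc, Fin.succ_last,
        lastColumnRingEquiv_X_last] using this
    rw [← hQP]
    push_cast
    constructor
    -- If the previous column lies in `Q`, the new minor gives nothing, but the second half of the
    -- induction hypothesis already supplies the extra 1.
    · by_cases hab : C (X (0, Fin.last n)) ∈ Q ∧ C (X (1, Fin.last n)) ∈ Q
      · exact (h2 (Fin.forall_fin_two.2 hab)).trans (height_comap_C_le Q)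
      · exact (add_le_add_left h1 1).trans (height_comap_C_add_one_le Q hlast hab)
    · intro h
      have hX : ∀ i, X i ∈ Q := fun i => by
        have := (hmem _).2 (h i)
        rwa [lastColumnRingEquiv_X_last] at this
      rw [add_assoc, one_add_one_eq_two]
      exact (add_le_add_left h1 2).trans (height_comap_C_add_two_le Q (hX 0) (hX 1))

variable {K}

theorem minor_swap {n : ℕ} (i j : Fin n) : minor K j i = -minor K i j := by
  rw [minor_eq, minor_eq]
  ring

theorem minor_mem_edgeIdeal {n : ℕ} {G : SimpleGraph (Fin n)} {i j : Fin n} (h : G.Adj i j) :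
    minor K i j ∈ edgeIdeal K G :=
  Ideal.subset_span ⟨i, j, h, rfl⟩

/-- If a prime ideal contains no `X_i`, the pairs whose minor it contains form a transitive
relation. -/
theorem minor_mem_trans {n : ℕ} {P : Ideal (MvPolynomial (Fin 2 × Fin n) K)} [hP : P.IsPrime]
    {i j k : Fin n} (hj : X (0, j) ∉ P) (hij : minor K i j ∈ P) (hjk : minor K j k ∈ P) :
    minor K i k ∈ P := by
  refine (hP.mem_or_mem (x := X (0, j)) ?_).resolve_left hj
  have : X (0, j) * minor K i k = X (0, i) * minor K j k + X (0, k) * minor K i j := by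
    simp only [minor_eq]
    ring
  rw [this]
  exact P.add_mem (P.mul_mem_left _ hjk) (P.mul_mem_left _ hij)

theorem le_height_edgeIdeal {n : ℕ} {G : SimpleGraph (Fin (n + 1))}
    (v : Fin (n + 1) ≃ Fin (n + 1)) (hv : ∀ i : Fin n, G.Adj (v i.castSucc) (v i.succ)) :
    (n : ℕ∞) ≤ (edgeIdeal K G).height := by
  rw [Ideal.height_eq_inf_minimalPrimes]
  refine le_iInf₂ fun P hP => ?_
  have := hP.isPrime
  let e := (renameEquiv K ((Equiv.refl (Fin 2)).prodCongr v)).toRingEquiv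
  rw [← RingEquiv.height_comap e P]
  have : (P.comap e).IsPrime := Ideal.IsPrime.comap _
  refine (le_height_of_consecutive_minor_mem K n (P.comap e) fun i => ?_).1
  rw [Ideal.mem_comap]
  have h := hP.le (minor_mem_edgeIdeal (K := K) (hv i))
  simpa [e, minor_eq] using h

/-! ### Upper bounds from Krull's height theorem. -/

/-- The minors of consecutive columns have a minimal prime that contains every minor. -/
theorem height_edgeIdeal_le {n : ℕ} (G : SimpleGraph (Fin (n + 1))) :
    (edgeIdeal K G).height ≤ n := by
  classical
  let s : Finset (MvPolynomial (Fin 2 × Fin (n + 1)) K) :=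
    Finset.univ.image fun i : Fin n => minor K i.castSucc i.succ
  -- At the point with all `X_i = 1` and all `Y_i = 0` every minor vanishes and no `X_i` does, so a
  -- minimal prime below `ker φ` avoids every `X_i`.
  let φ : MvPolynomial (Fin 2 × Fin (n + 1)) K →+* K := eval fun x => if x.1 = 0 then 1 else 0
  have : (RingHom.ker φ).IsPrime := RingHom.ker_isPrime φ
  have hs : Ideal.span (s : Set _) ≤ RingHom.ker φ := by
    rw [Ideal.span_le]
    intro f hf
    obtain ⟨i, -, rfl⟩ := Finset.mem_image.1 (Finset.mem_coe.1 hf)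
    simp [RingHom.mem_ker, minor_eq, φ]
  obtain ⟨P, hP, hPφ⟩ := Ideal.exists_minimalPrimes_le hs
  have := hP.isPrime
  have hX : ∀ i, X (0, i) ∉ P := fun i hi => by
    simpa [φ, RingHom.mem_ker] using hPφ hi
  have hstart : ∀ i, minor K 0 i ∈ P := fun i => by
    induction i using Fin.induction with
    | zero => simp [minor_eq, mul_comm]
    | succ i ih =>
      exact minor_mem_trans (hX _) ih
        (hP.le (Ideal.subset_span (Finset.mem_image_of_mem _ (Finset.mem_univ i))))
  have hall : ∀ i j, minor K i j ∈ P := fun i j => by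
    refine minor_mem_trans (hX 0) ?_ (hstart j)
    rw [minor_swap]
    exact P.neg_mem (hstart i)
  have hle : edgeIdeal K G ≤ P := by
    rw [edgeIdeal, Ideal.span_le]
    rintro _ ⟨i, j, -, rfl⟩
    exact hall i j
  calc (edgeIdeal K G).height ≤ P.height := Ideal.height_mono hle
    _ ≤ s.card := Ideal.height_le_card_of_mem_minimalPrimes_span_finset hP
    _ ≤ n := by exact_mod_cast Finset.card_image_le.trans (by simp)

/-- Killing the column of a vertex `v` bounds the height by two plus the number of edges that
avoid `v`. -/
theorem height_edgeIdeal_le_of_vertex {n : ℕ} (G : SimpleGraph (Fin n)) [DecidableRel G.Adj]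
    (v : Fin n) :
    (edgeIdeal K G).height ≤ (2 + (G.edgeFinset \ G.incidenceFinset v).card : ℕ) := by
  classical
  let s : Finset (MvPolynomial (Fin 2 × Fin n) K) :=
    {X (0, v), X (1, v)} ∪
      (G.edgeFinset \ G.incidenceFinset v).image fun e => minor K e.out.1 e.out.2
  -- All generators vanish at the origin, so the ideal is proper and has a minimal prime.
  have hs : Ideal.span (s : Set _) ≤ RingHom.ker (eval (0 : Fin 2 × Fin n → K)) := by
    rw [Ideal.span_le]
    intro f hf
    simp only [s, Finset.coe_union, Finset.coe_insert, Finset.coe_singleton, Finset.coe_image,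
      Set.mem_union, Set.mem_insert_iff, Set.mem_singleton_iff, Set.mem_image] at hf
    rcases hf with (rfl | rfl) | ⟨e, -, rfl⟩ <;> simp [RingHom.mem_ker, minor_eq]
  have hprime : (RingHom.ker (eval (0 : Fin 2 × Fin n → K))).IsPrime := RingHom.ker_isPrime _
  obtain ⟨P, hP, -⟩ := Ideal.exists_minimalPrimes_le hs
  have hXv : ∀ i, X (i, v) ∈ P := fun i => hP.le (Ideal.subset_span (by fin_cases i <;> simp [s]))
  have hle : edgeIdeal K G ≤ P := by
    rw [edgeIdeal, Ideal.span_le]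
    rintro _ ⟨i, j, hij, rfl⟩
    rw [SetLike.mem_coe]
    by_cases hi : i = v
    · subst hi
      rw [minor_eq]
      exact P.sub_mem (P.mul_mem_right _ (hXv _)) (P.mul_mem_right _ (hXv _))
    by_cases hj : j = v
    · subst hj
      rw [minor_eq]
      exact P.sub_mem (P.mul_mem_left _ (hXv _)) (P.mul_mem_left _ (hXv _))
    have hmem : s(i, j) ∈ G.edgeFinset \ G.incidenceFinset v := by
      simp [SimpleGraph.mem_incidenceFinset, SimpleGraph.incidenceSet, hij, Ne.symm hi, Ne.symm hj]
    have hout : minor K (s(i, j)).out.1 (s(i, j)).out.2 ∈ P :=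
      hP.le (Ideal.subset_span (Finset.mem_union_right _ (Finset.mem_image_of_mem _ hmem)))
    have hq : s((s(i, j)).out.1, (s(i, j)).out.2) = s(i, j) := Quot.out_eq _
    rcases Sym2.eq_iff.1 hq with ⟨h1, h2⟩ | ⟨h1, h2⟩ <;> rw [h1, h2] at hout
    · exact hout
    · rw [minor_swap]
      exact P.neg_mem hout
  calc (edgeIdeal K G).height ≤ P.height := Ideal.height_mono hle
    _ ≤ s.card := Ideal.height_le_card_of_mem_minimalPrimes_span_finset hP
    _ ≤ _ := by
      exact_mod_cast (Finset.card_union_le _ _).trans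
        (add_le_add Finset.card_le_two Finset.card_image_le)

end

/-! ### Hamilton paths. -/

theorem exists_equiv_of_hasHamiltonPath {n : ℕ} {G : SimpleGraph (Fin (n + 1))}
    (h : HasHamiltonPath G) :
    ∃ v : Fin (n + 1) ≃ Fin (n + 1), ∀ i : Fin n, G.Adj (v i.castSucc) (v i.succ) := by
  obtain ⟨a, b, p, hp⟩ := h
  have hlen : p.length = n := by simpa using hp.length_eq
  have hlen' : p.support.length = n + 1 := by simpa using hp.length_support
  refine ⟨(finCongr hlen'.symm).trans hp.getVertEquiv, fun i => ?_⟩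
  simpa using p.adj_getVert_succ (i := i) (by omega)

/-- A connected graph in which every degree is at most two has a Hamilton path. -/
theorem hasHamiltonPath_of_degree_le_two {n : ℕ} {G : SimpleGraph (Fin n)} [DecidableRel G.Adj]
    (hG : G.Connected) (hdeg : ∀ v, G.degree v ≤ 2) : HasHamiltonPath G := by
  classical
  have := hG.nonempty
  obtain ⟨u, v, p, hp, hmax⟩ := SimpleGraph.Walk.exists_isPath_forall_isPath_length_le_length G
  refine ⟨u, v, p, hp.isHamiltonian_of_mem fun w => ?_⟩
  by_contra hw
  obtain ⟨q⟩ := hG.preconnected u w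
  obtain ⟨d, -, hd1, hd2⟩ := q.exists_boundary_dart {x | x ∈ p.support} p.start_mem_support hw
  obtain ⟨⟨x, y⟩, hxy⟩ := d
  simp only [Set.mem_ofPred_eq] at hd1 hd2 hxy
  obtain ⟨i, rfl, hi⟩ := SimpleGraph.Walk.mem_support_iff_exists_getVert.1 hd1
  -- At an end of the longest path the edge to `y` would extend it; at an interior vertex `y` is a
  -- third neighbour.
  rcases Nat.eq_zero_or_pos i with rfl | hi0
  · rw [p.getVert_zero] at hxy
    have := hmax _ _ _ (hp.cons hd2 (h := hxy.symm))
    simp at this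
  rcases hi.eq_or_lt with rfl | hilt
  · rw [p.getVert_length] at hxy
    have := hmax _ _ _ (hp.concat hd2 hxy)
    simp at this
  have hprev : G.Adj (p.getVert i) (p.getVert (i - 1)) := by
    have := p.adj_getVert_succ (i := i - 1) (by omega)
    rw [Nat.sub_add_cancel hi0] at this
    exact this.symm
  have hnext := p.adj_getVert_succ hilt
  have hne : p.getVert (i - 1) ≠ p.getVert (i + 1) := fun h => by
    have := hp.getVert_injOn (by simp; omega) (by simp; omega) h
    omega
  have hcard : ({p.getVert (i - 1), p.getVert (i + 1), y} : Finset (Fin n)).card = 3 :=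
    Finset.card_eq_three.2 ⟨_, _, _, hne, fun h => hd2 (by rw [← h]; exact p.getVert_mem_support _),
      fun h => hd2 (by rw [← h]; exact p.getVert_mem_support _), rfl⟩
  have hsub : ({p.getVert (i - 1), p.getVert (i + 1), y} : Finset (Fin n)) ⊆
      G.neighborFinset (p.getVert i) := by
    intro z hz
    simp only [Finset.mem_insert, Finset.mem_singleton] at hz
    rw [SimpleGraph.mem_neighborFinset]
    rcases hz with rfl | rfl | rfl
    exacts [hprev, hnext, hxy]
  have := Finset.card_le_card hsub
  rw [hcard, SimpleGraph.card_neighborFinset_eq_degree] at this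
  exact absurd (hdeg (p.getVert i)) (by omega)

end BinomialEdge

theorem proposition5p1 (K : Type*) [Field K] (n : ℕ) (hn : 2 < n)
    (G : SimpleGraph (Fin n)) (hG : G.Connected) :
    (BinomialEdge.HasHamiltonPath G →
      (BinomialEdge.edgeIdeal K G).height = ((n - 1 : ℕ) : ℕ∞)) ∧
    (G.IsTree → (BinomialEdge.edgeIdeal K G).height = ((n - 1 : ℕ) : ℕ∞) →
      BinomialEdge.HasHamiltonPath G) := by
  classical
  obtain ⟨n, rfl⟩ : ∃ m, n = m + 1 := ⟨n - 1, by omega⟩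
  rw [Nat.add_sub_cancel]
  constructor
  · intro h
    obtain ⟨v, hv⟩ := BinomialEdge.exists_equiv_of_hasHamiltonPath h
    exact le_antisymm (BinomialEdge.height_edgeIdeal_le G)
      (BinomialEdge.le_height_edgeIdeal v hv)
  · intro hT hht
    refine BinomialEdge.hasHamiltonPath_of_degree_le_two hG fun v => ?_
    have h := BinomialEdge.height_edgeIdeal_le_of_vertex (K := K) G v
    rw [hht, Nat.cast_le, Finset.card_sdiff_of_subset (G.incidenceFinset_subset v),
      G.card_incidenceFinset_eq_degree] at h
    have hcard := hT.card_edgeFinset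
    rw [Fintype.card_fin] at hcard
    -- The bound on the degree by the number of edges keeps the natural subtraction in `h` from
    -- truncating.
    have hle := Finset.card_le_card (G.incidenceFinset_subset v)
    rw [G.card_incidenceFinset_eq_degree] at hle
    omega
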